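/- For a finite simple graph $G$ with $n \ge 1$ vertices, let $s_k(G)$ be the number of (not necessarily induced) subgraphs of $G$ with exactly $k$ vertices that are trees, and let $$P(G) = \frac{s_n(G)}{s_1(G) + s_2(G) + \cdots + s_n(G)}$$ be the probability that a uniformly random subtree of $G$ is spanning. Let $G(n,p)$ denote the Erdős–Rényi random graph on $n$ labelled vertices in which each of the $\binom n2$ possible edges is present independently with probability $p$. There exists an absolute constant $c > 0$ such that, for every choice of $p = p(n) \in [0,1]$, $$\lim_{n \to \infty} \mathbb{P}\big( P(G(n,p)) \le e^{-c/p} \big) = 1,$$ where $e^{-c/p}$ is read as $0$ if $p = 0$. Consequently, if $p = p(n) \to 0$ as $n \to \infty$, then $P(G(n,p)) \to 0$ in probability, that is, $\lim_{n\to\infty} \mathbb{P}\big( |P(G(n,p))| > \varepsilon \big) = 0$ for every $\varepsilon > 0$. -/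

import Mathlib

/-- `s_k(G)`: the number of (not necessarily induced) subgraphs of `G` with exactly `k` vertices
that are trees. -/
noncomputable def SimpleGraph.subtreeCount {V : Type*} (G : SimpleGraph V) (k : ℕ) : ℕ :=
  {H : G.Subgraph | H.coe.IsTree ∧ H.verts.ncard = k}.ncard

/-- `T(G) = s_1(G) + ... + s_n(G)`, with `n` the number of vertices of `G`. -/
noncomputable def SimpleGraph.totalSubtreeCount {V : Type*} [Fintype V] (G : SimpleGraph V) : ℕ :=
  ∑ k ∈ Finset.Icc 1 (Fintype.card V), G.subtreeCount k

/-- `P(G) = s_n(G) / T(G)`: the probability that a uniformly random subtree of `G` is spanning. -/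
noncomputable def SimpleGraph.spanningProb {V : Type*} [Fintype V] (G : SimpleGraph V) : ℝ :=
  (G.subtreeCount (Fintype.card V) : ℝ) / (G.totalSubtreeCount : ℝ)

/-- `e^{-c/p}`, read as its limit `0` at `p = 0`. -/
noncomputable def expNegDiv (c p : ℝ) : ℝ :=
  if p = 0 then 0 else Real.exp (-c / p)

/-! Spanning trees typically have linearly many leaves, and deleting leaves produces many smaller
subtrees.

Let `G` have maximum degree at most `Δ`. Deleting a set `A` of leaves from a spanning tree leaves a
subtree, which arises from at most `Δ ^ #A` spanning trees, since each deleted leaf hung on one of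
its at most `Δ` neighbours. Weighting by `Δ⁻¹ ^ #A` shows that the sum of `(1 + Δ⁻¹) ^ #leaves` over
spanning trees is at most the number of subtrees (`sum_one_add_pow_card_leafFinset_le`). If `G` also
has enough edges, edge switches that create leaves show that at least half of the spanning trees
have `m` or more leaves (`two_mul_card_few_leaves_le`). Together they give `P(G) ≤ exp (-m / (4Δ))`
(`spanningProb_le_exp`).

In `G(n, p)` with `np ≥ log n / 4`, Chernoff bounds allow `Δ` of order `np` and `m` of order `n`, so
`m / Δ` has order `1 / p`. For smaller `p`, a second moment argument gives an isolated vertex with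
high probability, and then `P(G) = 0`. -/

namespace SimpleGraph

open Finset MeasureTheory
open scoped Classical

/-! ### Edge switches in trees -/

section EdgeSwitch

variable {V : Type*} {G T : SimpleGraph V} {v w x y : V}

/-- The graph obtained from `T` by replacing the edge `wv` with the edge `wx`. -/
def switchEdge (T : SimpleGraph V) (w v x : V) : SimpleGraph V :=
  T.deleteEdges {s(w, v)} ⊔ edge w x

lemma switchEdge_adj {a b : V} : (T.switchEdge w v x).Adj a b ↔
    (T.Adj a b ∧ ¬ (a = w ∧ b = v ∨ a = v ∧ b = w)) ∨
      (a = w ∧ b = x ∨ a = x ∧ b = w) ∧ a ≠ b := by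
  simp [switchEdge, deleteEdges_adj, edge_adj]

/-- Follow a walk from `w`: each step either survives the deletion or crosses the edge `wv`, and in
the latter case it ends at `w` or `v` itself. -/
lemma Connected.reachable_deleteEdges_or (hT : T.Connected) (w v y : V) :
    (T.deleteEdges {s(w, v)}).Reachable w y ∨ (T.deleteEdges {s(w, v)}).Reachable v y := by
  obtain ⟨q⟩ := hT.preconnected w y
  suffices h : ∀ {a b : V}, T.Walk a b →
      (T.deleteEdges {s(w, v)}).Reachable w a ∨ (T.deleteEdges {s(w, v)}).Reachable v a →
      (T.deleteEdges {s(w, v)}).Reachable w b ∨ (T.deleteEdges {s(w, v)}).Reachable v b from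
    h q (.inl .rfl)
  intro a b q
  induction q with
  | nil => exact id
  | @cons a c b hac q ih =>
    intro h
    apply ih
    by_cases hs : s(a, c) = s(w, v)
    · rw [Sym2.eq_iff] at hs
      rcases hs with ⟨-, rfl⟩ | ⟨-, rfl⟩
      · exact .inr .rfl
      · exact .inl .rfl
    · have hadj : (T.deleteEdges {s(w, v)}).Adj a c := by simp [deleteEdges_adj, hac, hs]
      exact h.imp (·.trans hadj.reachable) (·.trans hadj.reachable)

/-- The first edge on the path from `w` to `x` in a tree separates `w` from `x`. -/
lemma IsTree.exists_adj_not_reachable_deleteEdges (hT : T.IsTree) (hwx : w ≠ x) :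
    ∃ v, T.Adj w v ∧ ¬ (T.deleteEdges {s(w, v)}).Reachable w x ∧
      (¬ T.Adj w x → ∃ u, u ≠ w ∧ T.Adj v u) := by
  classical
  obtain ⟨q, hq⟩ := hT.connected.exists_isPath w x
  have hnil : ¬ q.Nil := Walk.not_nil_of_ne hwx
  refine ⟨q.snd, q.adj_snd hnil, ?_, fun hadj => ?_⟩
  · rw [reachable_deleteEdges_iff_exists_walk]
    rintro ⟨r, hr⟩
    have h := (hT.existsUnique_path w x).unique hq r.toPath.2
    apply hr
    apply r.edges_toPath_subset_edges
    rw [← h]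
    exact q.mk_start_snd_mem_edges hnil
  · cases q with
    | nil => exact absurd rfl hwx
    | cons h q =>
      cases q with
      | nil => exact absurd h hadj
      | @cons a b c h' q =>
        refine ⟨b, ?_, by simpa using h'⟩
        rintro rfl
        simp at hq

/-- An edge separating `w` from `x` lies on every path between them, and a path has only its first
edge at its starting vertex. This makes switches invertible. -/
lemma IsTree.eq_of_not_reachable_deleteEdges (hT : T.IsTree)
    (hv : ¬ (T.deleteEdges {s(w, v)}).Reachable w x)
    (hy : ¬ (T.deleteEdges {s(w, y)}).Reachable w x) : v = y := by
  obtain ⟨q, hq⟩ := hT.connected.exists_isPath w x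
  rw [hq.eq_snd_of_mem_edges (q.mem_edges_of_not_reachable_deleteEdges hv),
    hq.eq_snd_of_mem_edges (q.mem_edges_of_not_reachable_deleteEdges hy)]

lemma IsTree.not_reachable_deleteEdges_of_adj (hT : T.IsTree) (hwv : T.Adj w v) :
    ¬ (T.deleteEdges {s(w, v)}).Reachable w v :=
  isAcyclic_iff_forall_adj_isBridge.mp hT.isAcyclic hwv

lemma IsTree.switchEdge (hT : T.IsTree)
    (hx : ¬ (T.deleteEdges {s(w, v)}).Reachable w x) : (T.switchEdge w v x).IsTree := by
  have hwx : w ≠ x := by rintro rfl; exact hx .rfl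
  refine ⟨?_, .sup_edge_of_not_reachable hx (hT.isAcyclic.anti (deleteEdges_le _))⟩
  have hvx := (hT.connected.reachable_deleteEdges_or w v x).resolve_left hx
  have hle : T.deleteEdges {s(w, v)} ≤ T.switchEdge w v x := le_sup_left
  have hadj : (T.switchEdge w v x).Adj w x := by simp [SimpleGraph.switchEdge, edge_adj, hwx]
  have hw : ∀ y, (T.switchEdge w v x).Reachable w y := fun y => by
    rcases hT.connected.reachable_deleteEdges_or w v y with h | h
    · exact h.mono hle
    · exact hadj.reachable.trans ((hvx.symm.trans h).mono hle)
  have := hT.connected.nonempty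
  exact ⟨fun a b => (hw a).symm.trans (hw b)⟩

lemma switchEdge_deleteEdges (hwx : ¬ T.Adj w x) :
    (T.switchEdge w v x).deleteEdges {s(w, x)} = T.deleteEdges {s(w, v)} := by
  ext a b
  simp only [switchEdge, deleteEdges_adj, sup_adj, edge_adj, Set.mem_singleton_iff, Sym2.eq_iff]
  have := T.adj_symm (u := x) (v := w)
  grind

lemma switchEdge_switchEdge (hwv : T.Adj w v) (hwx : ¬ T.Adj w x) :
    (T.switchEdge w v x).switchEdge w x v = T := by
  rw [switchEdge, switchEdge_deleteEdges hwx]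
  ext a b
  have := T.adj_symm hwv
  have := hwv.ne
  simp only [deleteEdges_adj, sup_adj, edge_adj, Set.mem_singleton_iff, Sym2.eq_iff]
  grind

/-- An edge switch in a tree is determined by its result, the pivot `w` and the vertex `v` that
loses an edge. -/
lemma IsTree.switchEdge_inj {T₁ T₂ : SimpleGraph V} {x₁ x₂ : V} (hT₁ : T₁.IsTree) (hT₂ : T₂.IsTree)
    (hv₁ : T₁.Adj w v) (hv₂ : T₂.Adj w v) (hx₁ : ¬ T₁.Adj w x₁) (hx₂ : ¬ T₂.Adj w x₂)
    (hr₁ : ¬ (T₁.deleteEdges {s(w, v)}).Reachable w x₁)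
    (hr₂ : ¬ (T₂.deleteEdges {s(w, v)}).Reachable w x₂)
    (h : T₁.switchEdge w v x₁ = T₂.switchEdge w v x₂) : T₁ = T₂ ∧ x₁ = x₂ := by
  have hx : x₁ = x₂ := by
    refine (hT₁.switchEdge hr₁).eq_of_not_reachable_deleteEdges (w := w) (x := v) ?_ ?_
    · rw [switchEdge_deleteEdges hx₁]
      exact hT₁.not_reachable_deleteEdges_of_adj hv₁
    · rw [h, switchEdge_deleteEdges hx₂]
      exact hT₂.not_reachable_deleteEdges_of_adj hv₂
  subst hx
  refine ⟨?_, rfl⟩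
  rw [← switchEdge_switchEdge hv₁ hx₁, h, switchEdge_switchEdge hv₂ hx₂]

end EdgeSwitch

/-! ### Most spanning trees have many leaves -/

section Leaves

variable {V : Type*} [Fintype V] {G T : SimpleGraph V} {v w x : V}

/-- The vertices of degree one. -/
noncomputable def leafFinset (T : SimpleGraph V) : Finset V :=
  univ.filter fun v => T.degree v = 1

/-- The spanning trees of `G`, as graphs on the same vertex type. -/
noncomputable def spanningTrees (G : SimpleGraph V) : Finset (SimpleGraph V) :=
  univ.filter fun T => T ≤ G ∧ T.IsTree

lemma mem_leafFinset : v ∈ T.leafFinset ↔ T.degree v = 1 := by simp [leafFinset]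

lemma mem_spanningTrees : T ∈ G.spanningTrees ↔ T ≤ G ∧ T.IsTree := by simp [spanningTrees]

/-- Only `v` loses degree: `w` trades one neighbour for another, and `x` rises from a positive
degree to at least two. -/
lemma leafFinset_switchEdge_subset (hwv : T.Adj w v) (hwx : ¬ T.Adj w x) (hne : w ≠ x)
    (hx : 0 < T.degree x) :
    (T.switchEdge w v x).leafFinset ⊆ insert v T.leafFinset := by
  intro y hy
  rw [mem_leafFinset] at hy
  rw [Finset.mem_insert, mem_leafFinset]
  by_cases hyv : y = v
  · exact .inl hyv
  refine .inr ?_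
  have hvw := hwv.ne
  by_cases hyx : y = x
  · subst hyx
    have h : (T.switchEdge w v y).neighborFinset y = insert w (T.neighborFinset y) := by
      ext z
      simp only [mem_neighborFinset, switchEdge_adj, Finset.mem_insert]
      grind
    rw [← card_neighborFinset_eq_degree, h, card_insert_of_notMem, card_neighborFinset_eq_degree]
      at hy
    · omega
    · simpa [adj_comm] using hwx
  by_cases hyw : y = w
  · subst hyw
    have h : (T.switchEdge y v x).neighborFinset y = insert x ((T.neighborFinset y).erase v) := by
      ext z
      simp only [mem_neighborFinset, switchEdge_adj, Finset.mem_insert, Finset.mem_erase]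
      grind
    rw [← card_neighborFinset_eq_degree, h, card_insert_of_notMem, card_erase_add_one,
      card_neighborFinset_eq_degree] at hy
    · exact hy
    · simpa using hwv
    · simp [hwx]
  · have h : (T.switchEdge w v x).neighborFinset y = T.neighborFinset y := by
      ext z
      simp only [mem_neighborFinset, switchEdge_adj]
      grind
    rwa [← card_neighborFinset_eq_degree, h, card_neighborFinset_eq_degree] at hy

lemma mem_leafFinset_switchEdge (hwv : T.Adj w v) (hwx : ¬ T.Adj w x) (hv : T.degree v = 2) :
    v ∈ (T.switchEdge w v x).leafFinset := by
  have hvx : v ≠ x := by rintro rfl; exact hwx hwv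
  have hvw := hwv.ne
  have h : (T.switchEdge w v x).neighborFinset v = (T.neighborFinset v).erase w := by
    ext z
    simp only [mem_neighborFinset, switchEdge_adj, Finset.mem_erase]
    grind
  rw [mem_leafFinset, ← card_neighborFinset_eq_degree, h, card_erase_of_mem (by simpa using hwv.symm),
    card_neighborFinset_eq_degree, hv]

lemma IsTree.sum_degree_add_two (hT : T.IsTree) :
    ∑ v, T.degree v + 2 = 2 * Fintype.card V := by
  rw [sum_degrees_eq_twice_card_edges, ← hT.card_edgeFinset]
  ring

lemma IsTree.degree_pos [Nontrivial V] (hT : T.IsTree) (v : V) : 0 < T.degree v :=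
  hT.connected.preconnected.degree_pos_of_nontrivial v

/-- In a tree, the total degree of the branching vertices is at most three times the number of
leaves. -/
lemma IsTree.sum_degree_branching_le [Nontrivial V] (hT : T.IsTree) :
    ∑ v with 3 ≤ T.degree v, T.degree v ≤ 3 * #T.leafFinset := by
  -- Pointwise, `d·[d ≥ 3] + 6 ≤ 3d + 3·[d = 1]` for `d ≥ 1`; in the sum, the degree total `2n - 2`
  -- absorbs the constants `6`.
  have h : ∑ v, ((if 3 ≤ T.degree v then T.degree v else 0) + 6) ≤
      ∑ v, (3 * T.degree v + 3 * if T.degree v = 1 then 1 else 0) := by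
    refine sum_le_sum fun v _ => ?_
    have := hT.degree_pos v
    split_ifs <;> omega
  have hsum := hT.sum_degree_add_two
  rw [sum_add_distrib, sum_add_distrib, ← mul_sum, ← mul_sum, ← sum_filter, ← card_filter,
    sum_const, card_univ, smul_eq_mul] at h
  rw [leafFinset]
  omega

/-- The switches `(w, v, x)` that turn `T` into another spanning tree of `G` in which `v` is a
leaf. -/
noncomputable def leafSwitches (G T : SimpleGraph V) : Finset (V × V × V) :=
  univ.filter fun (w, v, x) => G.Adj w x ∧ ¬ T.Adj w x ∧ T.Adj w v ∧
    ¬ (T.deleteEdges {s(w, v)}).Reachable w x ∧ T.degree v = 2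

lemma mem_leafSwitches : (w, v, x) ∈ leafSwitches G T ↔ G.Adj w x ∧ ¬ T.Adj w x ∧ T.Adj w v ∧
    ¬ (T.deleteEdges {s(w, v)}).Reachable w x ∧ T.degree v = 2 := by
  simp [leafSwitches]

lemma card_filter_adj (G : SimpleGraph V) :
    #(univ.filter fun q : V × V => G.Adj q.1 q.2) = ∑ v, G.degree v := by
  rw [← Finset.univ_product_univ, Finset.card_filter, Finset.sum_product]
  refine sum_congr rfl fun v _ => ?_
  rw [← card_filter, ← card_neighborFinset_eq_degree]
  congr 1
  ext
  simp

/-- Every ordered edge `(w, x)` of `G` outside `T` gives a switch through the second vertex `v` of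
the tree path from `w` to `x`, unless `v` branches. The pairs lost to branching are counted by
choosing `v`, then `w` next to `v` in `T`, then `x` next to `w` in `G`. -/
lemma IsTree.sum_degree_le_card_leafSwitches [Nontrivial V] (hT : T.IsTree) {Δ : ℕ}
    (hΔ : ∀ v, G.degree v ≤ Δ) :
    ∑ v, G.degree v ≤ #(leafSwitches G T) + 2 * Fintype.card V + 3 * #T.leafFinset * Δ := by
  set B : Finset (V × V) := (univ.filter fun v => 3 ≤ T.degree v).biUnion fun v =>
    (T.neighborFinset v).biUnion fun w => (G.neighborFinset w).image fun x => (w, x) with hB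
  have hcov : (univ.filter fun q : V × V => G.Adj q.1 q.2) ⊆
      (leafSwitches G T).image (fun q => (q.1, q.2.2)) ∪
        (univ.filter fun q : V × V => T.Adj q.1 q.2) ∪ B := by
    rintro ⟨w, x⟩ hq
    simp only [mem_filter, mem_univ, true_and] at hq
    by_cases hTwx : T.Adj w x
    · simp [hTwx]
    obtain ⟨v, hwv, hr, hu⟩ := hT.exists_adj_not_reachable_deleteEdges hq.ne
    obtain ⟨u, huw, hvu⟩ := hu hTwx
    have h2 : 2 ≤ T.degree v := by
      rw [← card_neighborFinset_eq_degree, ← card_pair huw]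
      apply card_le_card
      intro z
      simp only [Finset.mem_insert, Finset.mem_singleton, mem_neighborFinset]
      rintro (rfl | rfl)
      · exact hvu
      · exact hwv.symm
    rcases h2.eq_or_lt with h2 | h3
    · refine mem_union_left _ (mem_union_left _ (mem_image.mpr ⟨(w, v, x), ?_, rfl⟩))
      exact mem_leafSwitches.mpr ⟨hq, hTwx, hwv, hr, h2.symm⟩
    · refine mem_union_right _ ?_
      simp only [hB, mem_biUnion, mem_filter, mem_univ, true_and, mem_neighborFinset, mem_image]
      exact ⟨v, h3, w, hwv.symm, x, hq, rfl⟩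
  have hBcard : #B ≤ 3 * #T.leafFinset * Δ := by
    calc #B ≤ ∑ v with 3 ≤ T.degree v, ∑ w ∈ T.neighborFinset v, Δ := by
          refine card_biUnion_le.trans (sum_le_sum fun v _ => ?_)
          refine card_biUnion_le.trans (sum_le_sum fun w _ => ?_)
          exact card_image_le.trans ((card_neighborFinset_eq_degree ..).le.trans (hΔ w))
      _ = (∑ v with 3 ≤ T.degree v, T.degree v) * Δ := by
          rw [sum_mul]
          refine sum_congr rfl fun v _ => ?_
          rw [sum_const, card_neighborFinset_eq_degree, smul_eq_mul]
      _ ≤ _ := Nat.mul_le_mul_right _ hT.sum_degree_branching_le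
  have h := (card_le_card hcov).trans
    ((card_union_le _ _).trans (Nat.add_le_add_right (card_union_le _ _) _))
  rw [card_filter_adj, card_filter_adj] at h
  have h1 : #((leafSwitches G T).image fun q => (q.1, q.2.2)) ≤ #(leafSwitches G T) :=
    card_image_le
  have := hT.sum_degree_add_two
  omega

/-- If `G` has bounded maximum degree and enough edges, then at most half of its spanning trees
have fewer than `m` leaves. -/
theorem two_mul_card_few_leaves_le [Nontrivial V] {Δ m : ℕ} (hΔ : ∀ v, G.degree v ≤ Δ)
    (hΔ0 : 0 < Δ) (hG : 2 * Fintype.card V + 5 * m * Δ ≤ ∑ v, G.degree v) :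
    2 * #(G.spanningTrees.filter fun T => #T.leafFinset < m) ≤ #G.spanningTrees := by
  rcases Nat.eq_zero_or_pos m with rfl | hm
  · simp
  set B := G.spanningTrees.filter fun T => #T.leafFinset < m with hB
  -- Double counting: `Q` holds the switches out of trees with few leaves; `R` holds the data (new
  -- tree, new leaf `v`, pivot `w`) that determine a switch.
  set Q : Finset ((_ : SimpleGraph V) × V × V × V) := B.sigma fun T => leafSwitches G T with hQ
  set R : Finset ((_ : SimpleGraph V) × (_ : V) × V) :=
    (G.spanningTrees.filter fun T => #T.leafFinset ≤ m).sigma fun T =>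
      T.leafFinset.sigma fun v => G.neighborFinset v with hR
  -- `(2n + 5mΔ) - 2n - 3mΔ = 2mΔ` switches remain for each tree.
  have hQcard : #B * (2 * (m * Δ)) ≤ #Q := by
    rw [hQ, card_sigma, ← smul_eq_mul, ← sum_const]
    refine sum_le_sum fun T hT => ?_
    rw [hB, mem_filter, mem_spanningTrees] at hT
    have h := hT.1.2.sum_degree_le_card_leafSwitches hΔ
    have h' : 3 * #T.leafFinset * Δ ≤ 3 * m * Δ := by
      gcongr
      exact hT.2.le
    have e1 : 5 * m * Δ = 5 * (m * Δ) := by ring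
    have e2 : 3 * m * Δ = 3 * (m * Δ) := by ring
    omega
  have hRcard : #R ≤ #G.spanningTrees * (m * Δ) := by
    rw [hR, card_sigma]
    calc _ ≤ ∑ T ∈ G.spanningTrees.filter fun T => #T.leafFinset ≤ m, m * Δ := by
          refine sum_le_sum fun T hT => ?_
          rw [card_sigma]
          calc _ ≤ ∑ v ∈ T.leafFinset, Δ := sum_le_sum fun v _ =>
                (card_neighborFinset_eq_degree ..).le.trans (hΔ v)
            _ = #T.leafFinset * Δ := by rw [sum_const, smul_eq_mul]
            _ ≤ m * Δ := Nat.mul_le_mul_right _ (mem_filter.mp hT).2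
      _ ≤ _ := by
          rw [sum_const, smul_eq_mul]
          exact Nat.mul_le_mul_right _ (card_filter_le _ _)
  have hQR : #Q ≤ #R := by
    refine card_le_card_of_injOn
      (fun q => ⟨q.1.switchEdge q.2.1 q.2.2.1 q.2.2.2, q.2.2.1, q.2.1⟩) ?_ ?_
    · rintro ⟨T, w, v, x⟩ hq
      simp only [hQ, hB, coe_sigma, Set.mem_sigma_iff, mem_coe, mem_filter, mem_spanningTrees,
        mem_leafSwitches] at hq
      obtain ⟨⟨⟨hTG, hT⟩, hm⟩, hwx, hTwx, hwv, hr, h2⟩ := hq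
      simp only [hR, coe_sigma, Set.mem_sigma_iff, mem_coe, mem_filter, mem_spanningTrees,
        mem_neighborFinset]
      refine ⟨⟨⟨sup_le ((deleteEdges_le _).trans hTG) ?_, hT.switchEdge hr⟩, ?_⟩,
        mem_leafFinset_switchEdge hwv hTwx h2, (hTG hwv).symm⟩
      · exact (edge_le_iff _).mpr (.inr hwx)
      · have h := (card_le_card (leafFinset_switchEdge_subset hwv hTwx hwx.ne
          (hT.degree_pos x))).trans (card_insert_le _ _)
        omega
    · rintro ⟨T₁, w₁, v₁, x₁⟩ hq₁ ⟨T₂, w₂, v₂, x₂⟩ hq₂ h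
      simp only [hQ, hB, coe_sigma, Set.mem_sigma_iff, mem_coe, mem_filter, mem_spanningTrees,
        mem_leafSwitches] at hq₁ hq₂
      simp only [Sigma.mk.injEq, heq_eq_eq] at h
      obtain ⟨hs, rfl, rfl⟩ := h
      obtain ⟨⟨⟨-, hT₁⟩, -⟩, -, hTwx₁, hwv₁, hr₁, -⟩ := hq₁
      obtain ⟨⟨⟨-, hT₂⟩, -⟩, -, hTwx₂, hwv₂, hr₂, -⟩ := hq₂
      obtain ⟨rfl, rfl⟩ := hT₁.switchEdge_inj hT₂ hwv₁ hwv₂ hTwx₁ hTwx₂ hr₁ hr₂ hs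
      rfl
  have hpos : 0 < m * Δ := Nat.mul_pos hm hΔ0
  have := (hQcard.trans hQR).trans hRcard
  refine Nat.le_of_mul_le_mul_right ?_ hpos
  calc _ = #B * (2 * (m * Δ)) := by ring
    _ ≤ _ := this

end Leaves

/-! ### Subtrees obtained by removing leaves -/

section Pruning

variable {V : Type*} [Fintype V] {G T : SimpleGraph V}

/-- The subgraph of `G` obtained from `T` by removing the vertices in `A`. -/
def prune (G T : SimpleGraph V) (A : Finset V) : G.Subgraph where
  verts := {a | a ∉ A}
  Adj a b := (G.Adj a b ∧ T.Adj a b) ∧ a ∉ A ∧ b ∉ A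
  adj_sub h := h.1.1
  edge_vert h := h.2.1
  symm := ⟨fun _ _ h => ⟨⟨h.1.1.symm, h.1.2.symm⟩, h.2.2, h.2.1⟩⟩

/-- If all degrees were one, the degree sum would give `n + 2 = 2n`; the single edge is the
exception that forces `n ≥ 3`. -/
lemma IsTree.leafFinset_ne_univ (hT : T.IsTree) (hV : 3 ≤ Fintype.card V) :
    T.leafFinset ≠ univ := by
  intro h
  have hsum := hT.sum_degree_add_two
  have : ∑ v, T.degree v = Fintype.card V := by
    rw [Fintype.card_eq_sum_ones]
    exact sum_congr rfl fun v _ => mem_leafFinset.mp (h ▸ mem_univ v)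
  omega

lemma IsTree.prune (hT : T.IsTree) (hTG : T ≤ G) (hV : 3 ≤ Fintype.card V) {A : Finset V}
    (hA : A ⊆ T.leafFinset) : (prune G T A).coe.IsTree := by
  have hconn : (T.induce {a | a ∉ A}).IsTree := by
    refine ⟨?_, hT.isAcyclic.induce _⟩
    obtain ⟨a, ha⟩ : ∃ a, a ∉ A := by
      by_contra! h
      exact hT.leafFinset_ne_univ hV (eq_univ_of_forall fun a => hA (h a))
    have : Nonempty ({a | a ∉ A} : Set V) := ⟨⟨a, ha⟩⟩
    refine ⟨hT.connected.preconnected.induce_of_degree_eq_one fun v hv => ?_⟩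
    have hv' : v ∈ A := by simpa using hv
    obtain ⟨u, -, hu⟩ := degree_eq_one_iff_existsUnique_adj.mp (mem_leafFinset.mp (hA hv'))
    intro a ha b hb
    rw [hu a ha, hu b hb]
  have heq : (SimpleGraph.prune G T A).coe = T.induce {a | a ∉ A} := by
    ext a b
    exact ⟨fun h => h.1.2, fun h => ⟨⟨hTG h, h⟩, a.2, b.2⟩⟩
  rw [heq]
  exact hconn

/-- A neighbour of `v`, if there is one. -/
noncomputable def someNeighbor (T : SimpleGraph V) (v : V) : V :=
  if h : ∃ u, T.Adj v u then h.choose else v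

lemma adj_iff_eq_someNeighbor {v u : V} (hv : v ∈ T.leafFinset) :
    T.Adj v u ↔ u = T.someNeighbor v := by
  obtain ⟨a, ha, hu⟩ := degree_eq_one_iff_existsUnique_adj.mp (mem_leafFinset.mp hv)
  have h : ∃ u, T.Adj v u := ⟨a, ha⟩
  rw [someNeighbor, dif_pos h]
  constructor
  · intro hvu
    rw [hu _ hvu, hu _ h.choose_spec]
  · rintro rfl
    exact h.choose_spec

lemma eq_of_prune_eq {T₁ T₂ : SimpleGraph V} {A : Finset V} (h₁ : T₁ ≤ G) (h₂ : T₂ ≤ G)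
    (hA₁ : A ⊆ T₁.leafFinset) (hA₂ : A ⊆ T₂.leafFinset) (h : prune G T₁ A = prune G T₂ A)
    (hn : ∀ v ∈ A, T₁.someNeighbor v = T₂.someNeighbor v) : T₁ = T₂ := by
  ext a b
  by_cases ha : a ∈ A
  · rw [adj_iff_eq_someNeighbor (hA₁ ha), adj_iff_eq_someNeighbor (hA₂ ha), hn a ha]
  by_cases hb : b ∈ A
  · rw [adj_comm, T₂.adj_comm, adj_iff_eq_someNeighbor (hA₁ hb), adj_iff_eq_someNeighbor (hA₂ hb),
      hn b hb]
  have := congrArg (fun H : G.Subgraph => H.Adj a b) h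
  simp only [prune, ha, hb, not_false_eq_true, and_true, eq_iff_iff] at this
  exact ⟨fun hab => (this.mp ⟨h₁ hab, hab⟩).2, fun hab => (this.mpr ⟨h₂ hab, hab⟩).2⟩

/-- The subgraphs of `G` that are trees. -/
noncomputable def subtrees (G : SimpleGraph V) : Finset G.Subgraph :=
  univ.filter fun H => H.coe.IsTree

lemma totalSubtreeCount_eq_card (G : SimpleGraph V) : G.totalSubtreeCount = #G.subtrees := by
  rw [totalSubtreeCount, card_eq_sum_card_fiberwise (f := fun H => H.verts.ncard)
    (t := Finset.Icc 1 (Fintype.card V))]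
  · refine sum_congr rfl fun k _ => ?_
    rw [subtreeCount, ← Set.ncard_coe_finset]
    congr 1
    ext H
    simp [subtrees]
  · intro H hH
    simp only [subtrees, coe_filter, mem_univ, true_and, Set.mem_ofPred_eq] at hH
    have hne : H.verts.Nonempty := Set.nonempty_coe_sort.mp hH.connected.nonempty
    rw [mem_coe, Finset.mem_Icc, ← Nat.card_eq_fintype_card]
    exact ⟨(Set.ncard_pos (Set.toFinite _)).mpr hne, Set.ncard_le_card _⟩

lemma subtreeCount_card_le (G : SimpleGraph V) :
    G.subtreeCount (Fintype.card V) ≤ #G.spanningTrees := by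
  have huniv : ∀ H : G.Subgraph, H.verts.ncard = Fintype.card V → H.verts = Set.univ := by
    intro H hH
    rw [← Nat.card_eq_fintype_card] at hH
    exact (Set.eq_univ_iff_ncard _).mpr hH
  rw [subtreeCount, ← Set.ncard_coe_finset]
  refine Set.ncard_le_ncard_of_injOn (fun H => H.spanningCoe) ?_ ?_ (Set.toFinite _)
  · rintro H ⟨hH, hn⟩
    rw [mem_coe, mem_spanningTrees]
    have hs : H.IsSpanning := Subgraph.isSpanning_iff.mpr (huniv H hn)
    exact ⟨H.spanningCoe_le, (Subgraph.spanningCoeEquivCoeOfSpanning H hs).isTree_iff.mpr hH⟩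
  · rintro H₁ ⟨-, h₁⟩ H₂ ⟨-, h₂⟩ h
    refine Subgraph.ext ((huniv _ h₁).trans (huniv _ h₂).symm) ?_
    exact congrArg SimpleGraph.Adj h

/-- The tree is recovered from its pruned part and the neighbour in `G` to which each removed leaf
was attached. -/
lemma card_prune_fiber_le {Δ : ℕ} (hΔ : ∀ v, G.degree v ≤ Δ) (H : G.Subgraph) (A : Finset V) :
    #(G.spanningTrees.filter fun T => A ⊆ T.leafFinset ∧ prune G T A = H) ≤ Δ ^ #A := by
  calc _ ≤ #(Fintype.piFinset fun v => if v ∈ A then G.neighborFinset v else {v}) := by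
        refine card_le_card_of_injOn (fun T v => if v ∈ A then T.someNeighbor v else v) ?_ ?_
        · intro T hT
          simp only [coe_filter, mem_spanningTrees, Set.mem_ofPred_eq] at hT
          rw [mem_coe, Fintype.mem_piFinset]
          intro v
          by_cases hv : v ∈ A
          · simp only [hv, if_true, mem_neighborFinset]
            exact hT.1.1 ((adj_iff_eq_someNeighbor (hT.2.1 hv)).mpr rfl)
          · simp [hv]
        · intro T₁ hT₁ T₂ hT₂ h
          simp only [coe_filter, mem_spanningTrees, Set.mem_ofPred_eq] at hT₁ hT₂
          refine eq_of_prune_eq hT₁.1.1 hT₂.1.1 hT₁.2.1 hT₂.2.1 (hT₁.2.2.trans hT₂.2.2.symm)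
            fun v hv => ?_
          simpa [hv] using congrFun h v
    _ = ∏ v ∈ A, G.degree v := by
        rw [Fintype.card_piFinset, ← Finset.prod_filter_mul_prod_filter_not univ (· ∈ A),
          Finset.filter_mem_eq_inter, Finset.univ_inter]
        rw [Finset.prod_congr rfl (g := fun v => G.degree v) (fun v hv => by simp [hv]),
          Finset.prod_eq_one (s := univ.filter (· ∉ A))]
        · simp
        · intro v hv
          simp [(mem_filter.mp hv).2]
    _ ≤ Δ ^ #A := Finset.prod_le_pow_card _ _ _ fun v _ => hΔ v

/-- Removing sets of leaves from spanning trees bounds the number of subtrees from below. -/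
theorem sum_one_add_pow_card_leafFinset_le (hV : 3 ≤ Fintype.card V) {Δ : ℕ}
    (hΔ : ∀ v, G.degree v ≤ Δ) (hΔ0 : 0 < Δ) :
    ∑ T ∈ G.spanningTrees, ((Δ : ℝ)⁻¹ + 1) ^ #T.leafFinset ≤ G.totalSubtreeCount := by
  set Z : Finset ((_ : SimpleGraph V) × Finset V) :=
    G.spanningTrees.sigma fun T => T.leafFinset.powerset with hZ
  have hmaps : ∀ z ∈ Z, prune G z.1 z.2 ∈ G.subtrees := by
    rintro ⟨T, A⟩ hz
    simp only [hZ, mem_sigma, mem_spanningTrees, Finset.mem_powerset] at hz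
    simpa [subtrees] using hz.1.2.prune hz.1.1 hV hz.2
  -- Binomial expansion of `(Δ⁻¹ + 1) ^ #leaves` over sets of leaves.
  calc _ = ∑ z ∈ Z, ((Δ : ℝ)⁻¹) ^ #z.2 := by
        rw [hZ, sum_sigma]
        refine sum_congr rfl fun T _ => ?_
        rw [← sum_pow_mul_eq_add_pow]
        simp
    _ = ∑ H ∈ G.subtrees, ∑ z ∈ Z with prune G z.1 z.2 = H, ((Δ : ℝ)⁻¹) ^ #z.2 :=
        (sum_fiberwise_of_maps_to hmaps _).symm
    _ ≤ ∑ H ∈ G.subtrees, 1 := by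
        refine sum_le_sum fun H _ => ?_
        -- The removed set is forced by `H`: it is the complement of its vertex set.
        set A : Finset V := univ.filter fun v => v ∉ H.verts with hA
        have hzA : ∀ z ∈ Z.filter fun z => prune G z.1 z.2 = H, z.2 = A := by
          intro z hz
          rw [mem_filter] at hz
          ext v
          simp [hA, ← hz.2, prune]
        have hcard : #(Z.filter fun z => prune G z.1 z.2 = H) ≤ Δ ^ #A := by
          refine le_trans ?_ (card_prune_fiber_le hΔ H A)
          refine card_le_card_of_injOn (fun z => z.1) ?_ ?_
          · rintro ⟨T, B⟩ hz
            have hB : B = A := hzA _ hz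
            subst hB
            simp only [hZ, coe_filter, mem_sigma, Finset.mem_powerset, Set.mem_ofPred_eq] at hz
            simpa using ⟨hz.1.1, hz.1.2, hz.2⟩
          · rintro ⟨T, B⟩ hz ⟨T', B'⟩ hz' h
            have hB : B = A := hzA _ hz
            have hB' : B' = A := hzA _ hz'
            obtain rfl : T = T' := h
            rw [hB, hB']
        rw [sum_congr rfl fun z hz => by rw [hzA z hz], sum_const, nsmul_eq_mul, inv_pow,
          mul_inv_le_iff₀ (by positivity), one_mul]
        exact_mod_cast hcard
    _ = G.totalSubtreeCount := by simp [totalSubtreeCount_eq_card]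

lemma exp_half_le_one_add {x : ℝ} (h0 : 0 ≤ x) (h1 : x ≤ 1) : Real.exp (x / 2) ≤ x + 1 := by
  have h := Real.add_one_le_exp (-(x / 2))
  rw [Real.exp_neg] at h
  have hpos := Real.exp_pos (x / 2)
  rw [le_inv_comm₀ (by linarith) hpos] at h
  refine h.trans ?_
  rw [inv_le_iff_one_le_mul₀ (by linarith)]
  nlinarith

/-- If `G` has maximum degree at most `Δ` and enough edges, a random subtree of `G` is unlikely to
be spanning. -/
theorem spanningProb_le_exp (hV : 3 ≤ Fintype.card V) {Δ m : ℕ} (hΔ : ∀ v, G.degree v ≤ Δ)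
    (hΔ0 : 0 < Δ) (hG : 2 * Fintype.card V + 5 * m * Δ ≤ ∑ v, G.degree v) :
    G.spanningProb ≤ Real.exp (-(m / (4 * Δ))) := by
  have : Nontrivial V := Fintype.one_lt_card_iff_nontrivial.mp (by omega)
  have hB := two_mul_card_few_leaves_le hΔ hΔ0 hG
  have hsum := sum_one_add_pow_card_leafFinset_le hV hΔ hΔ0
  set z := Real.exp (m / (4 * Δ)) with hz
  set a : ℝ := (Δ : ℝ)⁻¹ + 1 with ha
  have hΔ1 : (1 : ℝ) ≤ Δ := by exact_mod_cast hΔ0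
  have ha1 : 1 ≤ a := le_add_of_nonneg_left (by positivity)
  have hya : z ^ 2 ≤ a ^ m := by
    calc z ^ 2 = Real.exp ((Δ : ℝ)⁻¹ / 2) ^ m := by
          rw [hz, ← Real.exp_nat_mul, ← Real.exp_nat_mul]
          congr 1
          push_cast
          field_simp
          ring
      _ ≤ _ := by
          gcongr
          exact exp_half_le_one_add (by positivity) (inv_le_one_of_one_le₀ hΔ1)
  set N := #G.spanningTrees with hN
  set b := #(G.spanningTrees.filter fun T => #T.leafFinset < m) with hb
  have hsplit : (b : ℝ) + (N - b) * a ^ m ≤ ∑ T ∈ G.spanningTrees, a ^ #T.leafFinset := by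
    rw [← sum_filter_add_sum_filter_not G.spanningTrees fun T => #T.leafFinset < m]
    have hc : (N : ℝ) - b = #(G.spanningTrees.filter fun T => ¬ #T.leafFinset < m) := by
      rw [hN, hb, ← card_filter_add_card_filter_not (s := G.spanningTrees)
        (fun T => #T.leafFinset < m)]
      push_cast
      ring
    rw [hc]
    refine add_le_add ?_ ?_
    · rw [hb, card_eq_sum_ones]
      push_cast
      exact sum_le_sum fun T _ => one_le_pow₀ ha1
    · rw [← nsmul_eq_mul, ← sum_const]
      refine sum_le_sum fun T hT => ?_
      exact pow_le_pow_right₀ ha1 (not_lt.mp (mem_filter.mp hT).2)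
  have hbN : 2 * (b : ℝ) ≤ N := by exact_mod_cast hB
  have hz1 : 1 ≤ z := Real.one_le_exp (by positivity)
  -- As `b ≤ N / 2`, the sum is at least `N (1 + a ^ m) / 2 ≥ N (1 + z ^ 2) / 2 ≥ N z`. Aiming for
  -- `z` rather than `z ^ 2` removes the factor `1 / 2`.
  have hmain : (N : ℝ) * z ≤ G.totalSubtreeCount := by
    refine le_trans ?_ (hsplit.trans hsum)
    have h1 : (1 : ℝ) ≤ a ^ m := one_le_pow₀ ha1
    nlinarith [mul_nonneg (sub_nonneg.mpr hbN) (sub_nonneg.mpr h1),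
      mul_nonneg (Nat.cast_nonneg (α := ℝ) N) (sq_nonneg (z - 1)),
      mul_nonneg (Nat.cast_nonneg (α := ℝ) N) (sub_nonneg.mpr hya)]
  have hs : (G.subtreeCount (Fintype.card V) : ℝ) ≤ N := by
    exact_mod_cast G.subtreeCount_card_le
  rw [spanningProb, Real.exp_neg, ← hz]
  refine div_le_of_le_mul₀ (by positivity) (by positivity) ?_
  rw [inv_mul_eq_div, le_div_iff₀ (by positivity)]
  exact (mul_le_mul_of_nonneg_right hs (by positivity)).trans hmain

/-- A graph with an isolated vertex has no spanning tree. -/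
lemma spanningProb_eq_zero_of_isolated (hV : 2 ≤ Fintype.card V) {v : V}
    (hv : ∀ u, ¬ G.Adj v u) : G.spanningProb = 0 := by
  have : Nontrivial V := Fintype.one_lt_card_iff_nontrivial.mp (by omega)
  have h : G.spanningTrees = ∅ := by
    refine Finset.eq_empty_of_forall_notMem fun T hT => ?_
    rw [mem_spanningTrees] at hT
    obtain ⟨u, hu⟩ := (T.degree_pos_iff_exists_adj v).mp (hT.2.degree_pos v)
    exact hv u (hT.1 hu)
  have := G.subtreeCount_card_le
  rw [h, card_empty, Nat.le_zero] at this
  simp [spanningProb, this]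

end Pruning

/-! ### Degrees, edges and isolated vertices of the binomial random graph -/

section RandomGraph

variable {V : Type*} [Fintype V]

instance : MeasurableSingletonClass (SimpleGraph V) where
  measurableSet_singleton G := by
    have h : ({G} : Set (SimpleGraph V)) = edgeSet ⁻¹' {G.edgeSet} := by
      ext H
      simp
    rw [h]
    exact measurable_edgeSet (MeasurableSet.singleton _)

/-- The expectation of a function of the binomial random graph. -/
noncomputable def binomialExpect (p : unitInterval) (f : SimpleGraph V → ℝ) : ℝ :=
  ∑ G, (binomialRandom V p).real {G} * f G

variable {p : unitInterval}

lemma binomialRandom_real_singleton (G : SimpleGraph V) :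
    (binomialRandom V p).real {G} =
      (p : ℝ) ^ #G.edgeFinset * (1 - p : ℝ) ^ #((⊤ : SimpleGraph V).edgeFinset \ G.edgeFinset) := by
  have h1 : G.edgeSet.ncard = #G.edgeFinset := by
    rw [← coe_edgeFinset, Set.ncard_coe_finset]
  have h2 : #((⊤ : SimpleGraph V).edgeFinset \ G.edgeFinset) =
      (Nat.card V).choose 2 - #G.edgeFinset := by
    rw [card_sdiff_of_subset (edgeFinset_mono le_top), card_edgeFinset_top_eq_card_choose_two,
      Nat.card_eq_fintype_card]
  rw [measureReal_def, binomialRandom_singleton, h1, h2]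
  simp

/-- Generating function of the number of edges in `S`, by expanding a product over all potential
edges. It is used with `t = e` and `t = e⁻¹` for the tail bounds, and with `t = 0` for isolated
vertices. -/
lemma binomialExpect_pow_card_inter (t : ℝ) {S : Finset (Sym2 V)}
    (hS : S ⊆ (⊤ : SimpleGraph V).edgeFinset) :
    binomialExpect p (fun G => t ^ #(G.edgeFinset ∩ S)) = (1 - p + p * t : ℝ) ^ #S := by
  set E := (⊤ : SimpleGraph V).edgeFinset with hE
  have h := Finset.prod_add (fun e => (p : ℝ) * if e ∈ S then t else 1) (fun _ => (1 - p : ℝ)) E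
  have hL : ∏ e ∈ E, ((p : ℝ) * (if e ∈ S then t else 1) + (1 - p)) =
      (1 - p + p * t : ℝ) ^ #S := by
    rw [← prod_sdiff hS, prod_eq_one, one_mul, prod_congr rfl (g := fun _ => (1 - p + p * t : ℝ)),
      prod_const]
    · intro e he
      rw [if_pos he]
      ring
    · intro e he
      rw [if_neg (mem_sdiff.mp he).2]
      ring
  rw [← hL, h, binomialExpect]
  refine sum_nbij' (fun G => G.edgeFinset) (fun s => fromEdgeSet (s : Set (Sym2 V))) ?_ ?_ ?_ ?_ ?_
  · intro G _
    exact Finset.mem_powerset.mpr (edgeFinset_mono le_top)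
  · intro s _
    exact mem_univ _
  · intro G _
    simp
  · intro s hs
    rw [Finset.mem_powerset] at hs
    rw [← Finset.coe_inj, coe_edgeFinset, edgeSet_fromEdgeSet, sdiff_eq_left, Set.disjoint_left]
    intro e he hd
    have := hs he
    rw [hE, mem_edgeFinset, edgeSet_top] at this
    exact this hd
  · intro G _
    rw [binomialRandom_real_singleton, prod_mul_distrib, prod_const, prod_const, prod_ite,
      prod_const, prod_const_one, mul_one, Finset.filter_mem_eq_inter]
    ring

lemma binomialExpect_one : binomialExpect p (fun _ : SimpleGraph V => (1 : ℝ)) = 1 := by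
  simpa using binomialExpect_pow_card_inter (V := V) (p := p) 1 (empty_subset _)

lemma binomialExpect_add (f g : SimpleGraph V → ℝ) :
    binomialExpect p (fun G => f G + g G) = binomialExpect p f + binomialExpect p g := by
  simp [binomialExpect, mul_add, sum_add_distrib]

lemma binomialExpect_const_mul (c : ℝ) (f : SimpleGraph V → ℝ) :
    binomialExpect p (fun G => c * f G) = c * binomialExpect p f := by
  simp only [binomialExpect, mul_sum]
  exact sum_congr rfl fun _ _ => by ring

lemma binomialExpect_sum {ι : Type*} (s : Finset ι) (f : ι → SimpleGraph V → ℝ) :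
    binomialExpect p (fun G => ∑ i ∈ s, f i G) = ∑ i ∈ s, binomialExpect p (f i) := by
  simp only [binomialExpect, mul_sum]
  exact sum_comm

/-- Markov's inequality. -/
lemma binomialRandom_real_le_expect {A : Set (SimpleGraph V)} {f : SimpleGraph V → ℝ}
    (h0 : ∀ G, 0 ≤ f G) (h1 : ∀ G ∈ A, 1 ≤ f G) :
    (binomialRandom V p).real A ≤ binomialExpect p f := by
  have hA : A = ↑(univ.filter fun G => G ∈ A) := by simp
  rw [hA, ← sum_measureReal_singleton, binomialExpect, sum_filter]
  refine sum_le_sum fun G _ => ?_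
  split_ifs with h
  · exact le_mul_of_one_le_right measureReal_nonneg (h1 G h)
  · exact mul_nonneg measureReal_nonneg (h0 G)

lemma edgeFinset_inter_incidenceFinset_top (G : SimpleGraph V) (v : V) :
    G.edgeFinset ∩ (⊤ : SimpleGraph V).incidenceFinset v = G.incidenceFinset v := by
  ext e
  simp only [mem_inter, mem_edgeFinset, mem_incidenceFinset, incidenceSet, Set.mem_sep_iff]
  exact ⟨fun h => ⟨h.1, h.2.2⟩, fun h => ⟨h.1, edgeSet_mono le_top h.1, h.2⟩⟩

lemma card_incidenceFinset_top (v : V) :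
    #((⊤ : SimpleGraph V).incidenceFinset v) = Fintype.card V - 1 := by
  rw [card_incidenceFinset_eq_degree, complete_graph_degree]

lemma one_add_pow_le_exp {x : ℝ} (hx : 0 ≤ 1 + x) (n : ℕ) : (1 + x) ^ n ≤ Real.exp (n * x) := by
  rw [Real.exp_nat_mul]
  gcongr
  linarith [Real.add_one_le_exp x]

/-- The maximum degree is unlikely to exceed ten times the mean. -/
lemma binomialRandom_exists_degree_gt_le :
    (binomialRandom V p).real {G | ∃ v, 10 * (Fintype.card V * p : ℝ) < G.degree v} ≤
      Fintype.card V * Real.exp (-8 * (Fintype.card V * p)) := by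
  set n := Fintype.card V with hn
  have hp0 : (0 : ℝ) ≤ p := p.2.1
  calc _ ≤ binomialExpect p (fun G : SimpleGraph V =>
        ∑ v, Real.exp (-(10 * (n * p : ℝ))) * Real.exp 1 ^ #(G.edgeFinset ∩
          (⊤ : SimpleGraph V).incidenceFinset v)) := by
        refine binomialRandom_real_le_expect (fun G => by positivity) ?_
        rintro G ⟨v, hv⟩
        refine le_trans ?_ (single_le_sum (fun v _ => by positivity) (mem_univ v))
        rw [edgeFinset_inter_incidenceFinset_top, card_incidenceFinset_eq_degree,
          ← Real.exp_nat_mul, ← Real.exp_add]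
        apply Real.one_le_exp
        linarith
    _ = n * (Real.exp (-(10 * (n * p : ℝ))) * (1 + p * (Real.exp 1 - 1) : ℝ) ^ (n - 1)) := by
        rw [binomialExpect_sum]
        rw [sum_congr rfl fun v _ => by
          rw [binomialExpect_const_mul,
            binomialExpect_pow_card_inter _ (incidenceFinset_subset _ v), card_incidenceFinset_top]]
        rw [sum_const, card_univ, nsmul_eq_mul]
        congr 3
        ring
    _ ≤ _ := by
        -- The exponent is at most `(-10 + (e - 1)) np`, and `e - 1 < 2`.
        have he := Real.exp_one_lt_d9
        have he1 : 0 ≤ Real.exp 1 - 1 := by linarith [Real.add_one_le_exp 1]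
        have h1 : 0 ≤ p * (Real.exp 1 - 1) := mul_nonneg hp0 he1
        gcongr
        calc _ ≤ Real.exp (-(10 * (n * p : ℝ))) * Real.exp (n * (p * (Real.exp 1 - 1))) := by
              gcongr
              refine (pow_le_pow_right₀ (by linarith) (Nat.sub_le n 1)).trans ?_
              exact one_add_pow_le_exp (by linarith) n
          _ ≤ _ := by
              rw [← Real.exp_add]
              apply Real.exp_le_exp.mpr
              have : 0 ≤ (n * p : ℝ) := by positivity
              nlinarith

/-- The number of edges is unlikely to be below half the mean. -/
lemma binomialRandom_card_edgeFinset_lt_le :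
    (binomialRandom V p).real {G | (#G.edgeFinset : ℝ) < p * (Fintype.card V).choose 2 / 2} ≤
      Real.exp (-(p * (Fintype.card V).choose 2 / 8)) := by
  set N := (Fintype.card V).choose 2 with hN
  have hp0 : (0 : ℝ) ≤ p := p.2.1
  have hp1 : (p : ℝ) ≤ 1 := p.2.2
  calc _ ≤ binomialExpect p (fun G : SimpleGraph V =>
        Real.exp (p * N / 2) * Real.exp (-1) ^ #(G.edgeFinset ∩
          (⊤ : SimpleGraph V).edgeFinset)) := by
        refine binomialRandom_real_le_expect (fun G => by positivity) ?_
        intro G hG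
        rw [Set.mem_ofPred_eq] at hG
        rw [inter_eq_left.mpr (edgeFinset_mono le_top), ← Real.exp_nat_mul, ← Real.exp_add]
        apply Real.one_le_exp
        linarith
    _ = Real.exp (p * N / 2) * (1 + p * (Real.exp (-1) - 1) : ℝ) ^ N := by
        rw [binomialExpect_const_mul, binomialExpect_pow_card_inter _ subset_rfl,
          card_edgeFinset_top_eq_card_choose_two]
        congr 2
        ring
    _ ≤ Real.exp (p * N / 2) * Real.exp (N * (p * (Real.exp (-1) - 1))) := by
        gcongr
        refine one_add_pow_le_exp ?_ N
        have := Real.exp_pos (-1)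
        nlinarith
    _ ≤ _ := by
        rw [← Real.exp_add]
        apply Real.exp_le_exp.mpr
        -- This gives the exponent `1/2 + 3/8 - 1 = -1/8` per unit of `pN`.
        have h : Real.exp (-1) ≤ 3 / 8 := by
          rw [Real.exp_neg, inv_le_comm₀ (Real.exp_pos _) (by norm_num)]
          linarith [Real.exp_one_gt_d9]
        have : 0 ≤ (p * N : ℝ) := by positivity
        nlinarith

/-- The indicator of `v` being isolated, as a function of the edges. -/
lemma zero_pow_card_incidence (G : SimpleGraph V) (v : V) :
    (0 : ℝ) ^ #(G.edgeFinset ∩ (⊤ : SimpleGraph V).incidenceFinset v) =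
      if G.degree v = 0 then 1 else 0 := by
  rw [edgeFinset_inter_incidenceFinset_top, card_incidenceFinset_eq_degree, zero_pow_eq]

lemma card_incidenceFinset_top_union {u v : V} (huv : u ≠ v) :
    #((⊤ : SimpleGraph V).incidenceFinset u ∪ (⊤ : SimpleGraph V).incidenceFinset v) =
      2 * Fintype.card V - 3 := by
  have h := card_union_add_card_inter ((⊤ : SimpleGraph V).incidenceFinset u)
    ((⊤ : SimpleGraph V).incidenceFinset v)
  have hi : (⊤ : SimpleGraph V).incidenceFinset u ∩ (⊤ : SimpleGraph V).incidenceFinset v =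
      {s(u, v)} := by
    rw [← Finset.coe_inj, coe_inter, coe_incidenceFinset, coe_incidenceFinset,
      incidenceSet_inter_incidenceSet_of_adj _ (by simpa using huv), coe_singleton]
  rw [hi, card_singleton, card_incidenceFinset_top, card_incidenceFinset_top] at h
  omega

/-- Second moment bound for the absence of isolated vertices. -/
lemma binomialRandom_no_isolated_le (hV : 2 ≤ Fintype.card V) (hp : (p : ℝ) < 1) :
    (binomialRandom V p).real {G | ∀ v, G.degree v ≠ 0} ≤
      (Fintype.card V * (1 - p : ℝ) ^ (Fintype.card V - 1))⁻¹ + p / (1 - p) := by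
  set n := Fintype.card V with hn
  set q : ℝ := 1 - p with hq
  have hq0 : 0 < q := by linarith
  have hn0 : (0 : ℝ) < n := by exact_mod_cast (by omega : 0 < n)
  set a : ℝ := n * q ^ (n - 1) with ha
  have ha0 : 0 < a := by positivity
  set I : V → SimpleGraph V → ℝ := fun v G =>
    (0 : ℝ) ^ #(G.edgeFinset ∩ (⊤ : SimpleGraph V).incidenceFinset v) with hI
  have hI1 : ∀ v, binomialExpect p (I v) = q ^ (n - 1) := fun v => by
    rw [hI, binomialExpect_pow_card_inter _ (incidenceFinset_subset _ v), card_incidenceFinset_top]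
    simp [hq, hn]
  have hI2 : ∀ u v, u ≠ v → binomialExpect p (fun G => I u G * I v G) = q ^ (2 * n - 3) := by
    intro u v huv
    have : (fun G => I u G * I v G) = fun G : SimpleGraph V => (0 : ℝ) ^ #(G.edgeFinset ∩
        ((⊤ : SimpleGraph V).incidenceFinset u ∪ (⊤ : SimpleGraph V).incidenceFinset v)) := by
      ext G
      simp only [hI, zero_pow_eq, inter_union_distrib_left, card_eq_zero, union_eq_empty]
      split_ifs <;> simp_all
    rw [this, binomialExpect_pow_card_inter _ (union_subset (incidenceFinset_subset _ u)
      (incidenceFinset_subset _ v)), card_incidenceFinset_top_union huv]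
    simp [hq, hn]
  have hI3 : ∀ v, binomialExpect p (fun G => I v G * I v G) = q ^ (n - 1) := by
    intro v
    rw [← hI1 v]
    congr 1
    ext G
    simp only [hI, zero_pow_eq]
    split_ifs <;> simp
  have hX : binomialExpect p (fun G => ∑ v, I v G) = a := by
    rw [binomialExpect_sum, sum_congr rfl fun v _ => hI1 v, sum_const, card_univ, nsmul_eq_mul]
  have hX2 : binomialExpect p (fun G => ∑ u, ∑ v, I u G * I v G) =
      n * q ^ (n - 1) + n * (n - 1) * q ^ (2 * n - 3) := by
    rw [binomialExpect_sum]
    rw [sum_congr rfl fun u _ => binomialExpect_sum _ _]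
    have : ∀ u : V, ∑ v, binomialExpect p (fun G => I u G * I v G) =
        q ^ (n - 1) + (n - 1) * q ^ (2 * n - 3) := by
      intro u
      rw [← add_sum_erase _ _ (mem_univ u), hI3,
        sum_congr rfl fun v hv => hI2 u v (Finset.ne_of_mem_erase hv).symm, sum_const,
        card_erase_of_mem (mem_univ u), card_univ, nsmul_eq_mul, Nat.cast_sub (by omega)]
      simp [hn]
    rw [sum_congr rfl fun u _ => this u, sum_const, card_univ, nsmul_eq_mul]
    ring
  -- The stars at two vertices share one edge, so the joint probability exceeds the product by a
  -- factor `q⁻¹`; this produces the term `p / (1 - p)`.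
  have hqq : q ^ (2 * n - 3) * q = q ^ (n - 1) * q ^ (n - 1) := by
    rw [← pow_succ, ← pow_add]
    congr 1
    omega
  -- Chebyshev: with `X` the number of isolated vertices and `a` its mean, `(X / a - 1) ^ 2` equals
  -- `1` when `X = 0`.
  calc _ ≤ binomialExpect p (fun G => ((a⁻¹) ^ 2 * (∑ u, ∑ v, I u G * I v G) +
        (-2 * a⁻¹) * (∑ v, I v G)) + 1) := by
        have hsq : ∀ G : SimpleGraph V, ((a⁻¹) ^ 2 * (∑ u, ∑ v, I u G * I v G) +
            (-2 * a⁻¹) * (∑ v, I v G)) + 1 = (a⁻¹ * (∑ v, I v G) - 1) ^ 2 := by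
          intro G
          rw [← Finset.sum_mul_sum]
          ring
        refine binomialRandom_real_le_expect (fun G => ?_) fun G hG => ?_
        · rw [hsq]
          positivity
        · rw [hsq, sum_eq_zero]
          · norm_num
          · intro v _
            exact (zero_pow_card_incidence G v).trans (if_neg (hG v))
    _ = a⁻¹ + (((n - 1) / n) * q⁻¹ - 1) := by
        rw [binomialExpect_add, binomialExpect_add, binomialExpect_const_mul,
          binomialExpect_const_mul, binomialExpect_one, hX, hX2]
        have h2 : q ^ (2 * n - 3) = q ^ (n - 1) * q ^ (n - 1) * q⁻¹ := by
          rw [← hqq]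
          field_simp
        rw [h2, ha]
        field_simp
        ring
    _ ≤ _ := by
        have h1 : ((n : ℝ) - 1) / n ≤ 1 := by
          rw [div_le_one hn0]
          linarith
        have h2 : (p : ℝ) / q = q⁻¹ - 1 := by
          rw [hq] at hq0 ⊢
          field_simp
          ring
        rw [h2]
        have : 0 < q⁻¹ := by positivity
        nlinarith

end RandomGraph

/-! ### The sparse and dense regimes -/

section SpanningProbability

variable {V : Type*} [Fintype V] {p : unitInterval}

lemma spanningProb_le_expNegDiv_of_degrees {G : SimpleGraph V} (hV : 800 ≤ Fintype.card V)
    (hp : 16 ≤ (Fintype.card V * p : ℝ))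
    (hdeg : ∀ v, (G.degree v : ℝ) ≤ 10 * (Fintype.card V * p : ℝ))
    (hedge : (p : ℝ) * (Fintype.card V).choose 2 / 2 ≤ #G.edgeFinset) :
    G.spanningProb ≤ expNegDiv (1 / 32000) p := by
  set n := Fintype.card V with hn
  have hn0 : (800 : ℝ) ≤ n := by exact_mod_cast hV
  have hp0 : (0 : ℝ) < p := by
    by_contra h
    nlinarith
  set Δ := ⌊10 * (n * p : ℝ)⌋₊ with hΔ
  -- Then `5mΔ ≤ n²p / 8`, and `np ≥ 16` gives `2n ≤ n²p / 8`, so the total stays below the degree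
  -- sum, which is at least `pn(n - 1) / 2`. Rounding leaves `m ≥ n / 800`, whence `m / (4Δ) ≥ (n /
  -- 800) / (40np) = 1 / (32000p)`.
  set m := n / 400 with hm
  have hΔle : (Δ : ℝ) ≤ 10 * (n * p) := Nat.floor_le (by positivity)
  have hΔ0 : 0 < Δ := Nat.floor_pos.mpr (by linarith)
  have hmle : (m : ℝ) * 400 ≤ n := by exact_mod_cast Nat.div_mul_le_self n 400
  have hmge : (n : ℝ) ≤ 800 * m := by exact_mod_cast (by omega : n ≤ 800 * m)
  have hG : 2 * n + 5 * m * Δ ≤ ∑ v, G.degree v := by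
    rw [sum_degrees_eq_twice_card_edges]
    have h2 : (n.choose 2 : ℝ) = n * (n - 1) / 2 := Nat.cast_choose_two ℝ n
    rw [h2] at hedge
    have h3 : (m : ℝ) * Δ ≤ (n / 400) * (10 * (n * p)) := by
      gcongr
      linarith
    have h4 : (2 * n + 5 * m * Δ : ℝ) ≤ 2 * #G.edgeFinset := by
      nlinarith [mul_nonneg hp0.le (by linarith : (0 : ℝ) ≤ n)]
    exact_mod_cast h4
  refine (spanningProb_le_exp (by omega) (fun v => Nat.le_floor (hdeg v)) hΔ0 hG).trans ?_
  rw [expNegDiv, if_neg hp0.ne']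
  apply Real.exp_le_exp.mpr
  rw [neg_div, neg_le_neg_iff, div_le_div_iff₀ hp0 (by positivity)]
  nlinarith

lemma exp_neg_two_mul_le {x : ℝ} (h0 : 0 ≤ x) (h1 : x ≤ 1 / 2) : Real.exp (-(2 * x)) ≤ 1 - x := by
  rw [Real.exp_neg, inv_le_iff_one_le_mul₀ (Real.exp_pos _)]
  nlinarith [Real.add_one_le_exp (2 * x)]

/-- The expected number of isolated vertices is at least `n * exp (-2np) ≥ √n`. An isolated vertex
makes `spanningProb` exactly `0`, so any `c` works, and `p = 0` is covered. -/
lemma binomialRandom_lt_spanningProb_le_of_sparse (hV : 2 ≤ Fintype.card V) {c : ℝ}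
    (hlog : Real.log (Fintype.card V) ≤ Fintype.card V)
    (hp : (Fintype.card V * p : ℝ) ≤ Real.log (Fintype.card V) / 4) :
    (binomialRandom V p).real {G | ¬ G.spanningProb ≤ expNegDiv c p} ≤
      Real.exp (-(Real.log (Fintype.card V) / 2)) +
        Real.log (Fintype.card V) / Fintype.card V := by
  set n := Fintype.card V with hn
  have hn0 : (0 : ℝ) < n := by exact_mod_cast (by omega : 0 < n)
  have hp0 : (0 : ℝ) ≤ p := p.2.1
  have hp2 : (p : ℝ) ≤ Real.log n / n / 4 := by
    rw [div_div, mul_comm (n : ℝ) 4, ← div_div, le_div_iff₀ hn0]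
    linarith
  have hpn : Real.log n / n ≤ 1 := (div_le_one hn0).mpr hlog
  have hsub : {G : SimpleGraph V | ¬ G.spanningProb ≤ expNegDiv c p} ⊆
      {G | ∀ v, G.degree v ≠ 0} := by
    intro G hG v hv
    apply hG
    rw [spanningProb_eq_zero_of_isolated hV (v := v)]
    · rw [expNegDiv]
      split_ifs <;> positivity
    · intro u hu
      have := (G.degree_pos_iff_exists_adj v).mpr ⟨u, hu⟩
      omega
  refine (measureReal_mono hsub).trans
    ((binomialRandom_no_isolated_le hV (by linarith)).trans (add_le_add ?_ ?_))
  · rw [Real.exp_neg]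
    gcongr
    have hq := exp_neg_two_mul_le hp0 (by linarith)
    calc Real.exp (Real.log n / 2)
        ≤ Real.exp (Real.log n + n * (-(2 * p))) := by
          apply Real.exp_le_exp.mpr
          linarith
      _ = n * Real.exp (-(2 * p)) ^ n := by
          rw [Real.exp_add, Real.exp_log hn0, Real.exp_nat_mul]
      _ ≤ n * (1 - p : ℝ) ^ n := by gcongr
      _ ≤ n * (1 - p : ℝ) ^ (n - 1) := by
          gcongr ?_ * ?_
          exact pow_le_pow_of_le_one (by linarith) (by linarith) (Nat.sub_le n 1)
  · rw [div_le_iff₀ (by linarith)]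
    nlinarith

/-- `log n ≥ 64` supplies `np ≥ 16`, and each of the two exceptional events has probability at most
`1 / n`. -/
lemma binomialRandom_lt_spanningProb_le_of_dense (hV : 800 ≤ Fintype.card V)
    (hlog : 64 ≤ Real.log (Fintype.card V))
    (hp : Real.log (Fintype.card V) / 4 ≤ (Fintype.card V * p : ℝ)) :
    (binomialRandom V p).real {G | ¬ G.spanningProb ≤ expNegDiv (1 / 32000) p} ≤
      2 * (Fintype.card V : ℝ)⁻¹ := by
  set n := Fintype.card V with hn
  have hn0 : (800 : ℝ) ≤ n := by exact_mod_cast hV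
  have hnlog : Real.exp (-Real.log n) = (n : ℝ)⁻¹ := by
    rw [Real.exp_neg, Real.exp_log (by linarith)]
  have hsub : {G : SimpleGraph V | ¬ G.spanningProb ≤ expNegDiv (1 / 32000) p} ⊆
      {G | ∃ v, 10 * (n * p : ℝ) < G.degree v} ∪
        {G | (#G.edgeFinset : ℝ) < p * n.choose 2 / 2} := by
    intro G hG
    by_contra h
    simp only [Set.mem_union, Set.mem_ofPred_eq, not_or, not_exists, not_lt] at h
    exact hG (spanningProb_le_expNegDiv_of_degrees hV (by linarith) h.1 h.2)
  refine (measureReal_mono hsub).trans ((measureReal_union_le _ _).trans ?_)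
  rw [two_mul]
  refine add_le_add (binomialRandom_exists_degree_gt_le.trans ?_)
    (binomialRandom_card_edgeFinset_lt_le.trans ?_)
  · calc (n : ℝ) * Real.exp (-8 * (n * p)) ≤ n * Real.exp (-Real.log n + -Real.log n) := by
          gcongr
          linarith
      _ = (n : ℝ)⁻¹ := by
          rw [Real.exp_add, hnlog]
          field_simp
  · rw [← hnlog]
    apply Real.exp_le_exp.mpr
    have h2 : (n.choose 2 : ℝ) = n * (n - 1) / 2 := Nat.cast_choose_two ℝ n
    rw [← hn, h2]
    nlinarith

end SpanningProbability

/-- With high probability, `P(G(n, p)) ≤ exp (-c / p)` with `c = 1 / 32000`. -/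
theorem tendsto_binomialRandom_spanningProb_le (p : ℕ → unitInterval) :
    Filter.Tendsto
      (fun n : ℕ => (binomialRandom (Fin n) (p n)).real
        {G : SimpleGraph (Fin n) | G.spanningProb ≤ expNegDiv (1 / 32000) (p n : ℝ)})
      Filter.atTop (nhds 1) := by
  set F : ℕ → ℝ := fun n =>
    Real.exp (-(Real.log n / 2)) + Real.log n / n + 2 * (n : ℝ)⁻¹ with hF
  have hlog : Filter.Tendsto (fun n : ℕ => Real.log n) Filter.atTop Filter.atTop :=
    Real.tendsto_log_atTop.comp tendsto_natCast_atTop_atTop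
  have hdiv : Filter.Tendsto (fun n : ℕ => Real.log n / n) Filter.atTop (nhds 0) := by
    have h := (Real.isLittleO_log_id_atTop.tendsto_div_nhds_zero).comp
      (tendsto_natCast_atTop_atTop (R := ℝ))
    exact h
  have hF0 : Filter.Tendsto F Filter.atTop (nhds 0) := by
    have h1 : Filter.Tendsto (fun n : ℕ => Real.exp (-(Real.log n / 2))) Filter.atTop (nhds 0) :=
      Real.tendsto_exp_neg_atTop_nhds_zero.comp (hlog.atTop_div_const (by norm_num))
    have h3 : Filter.Tendsto (fun n : ℕ => 2 * (n : ℝ)⁻¹) Filter.atTop (nhds (2 * 0)) :=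
      tendsto_inv_atTop_nhds_zero_nat.const_mul 2
    simpa using (h1.add hdiv).add h3
  have hbad : ∀ᶠ n : ℕ in Filter.atTop, (binomialRandom (Fin n) (p n)).real
      {G : SimpleGraph (Fin n) | ¬ G.spanningProb ≤ expNegDiv (1 / 32000) (p n : ℝ)} ≤ F n := by
    filter_upwards [Filter.eventually_ge_atTop 800, hlog.eventually_ge_atTop 64]
      with n hn hn64
    have h1 : 0 ≤ Real.exp (-(Real.log n / 2)) := (Real.exp_pos _).le
    have h2 : 0 ≤ Real.log n / n := by positivity
    have h3 : 0 ≤ 2 * (n : ℝ)⁻¹ := by positivity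
    rcases le_total (n * (p n : ℝ)) (Real.log n / 4) with hp | hp
    · have := binomialRandom_lt_spanningProb_le_of_sparse (V := Fin n) (p := p n)
        (c := 1 / 32000) (by simp; omega) (by simpa using Real.log_le_self n.cast_nonneg)
        (by simpa using hp)
      simp only [Fintype.card_fin] at this
      simp only [hF]
      linarith
    · have := binomialRandom_lt_spanningProb_le_of_dense (V := Fin n) (p := p n)
        (by simpa using hn) (by simpa using hn64) (by simpa using hp)
      simp only [Fintype.card_fin] at this
      simp only [hF]
      linarith
  refine tendsto_of_tendsto_of_tendsto_of_le_of_le' (g := fun n => 1 - F n) (h := fun _ => 1)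
    (by simpa using hF0.const_sub 1) tendsto_const_nhds ?_ (.of_forall fun n => measureReal_le_one)
  filter_upwards [hbad] with n hn
  have h := probReal_compl_eq_one_sub (μ := binomialRandom (Fin n) (p n))
    (s := {G : SimpleGraph (Fin n) | G.spanningProb ≤ expNegDiv (1 / 32000) (p n : ℝ)})
    (Set.toFinite _).measurableSet
  rw [Set.compl_ofPred] at h
  linarith

end SimpleGraph

theorem mainTheorem3 :
    (∃ c : ℝ, 0 < c ∧ ∀ p : ℕ → unitInterval,
      Filter.Tendsto
        (fun n : ℕ => (SimpleGraph.binomialRandom (Fin n) (p n)).real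
          {G : SimpleGraph (Fin n) | G.spanningProb ≤ expNegDiv c (p n : ℝ)})
        Filter.atTop (nhds 1)) ∧
    (∀ p : ℕ → unitInterval,
      Filter.Tendsto (fun n : ℕ => (p n : ℝ)) Filter.atTop (nhds 0) →
      ∀ ε : ℝ, 0 < ε →
        Filter.Tendsto
          (fun n : ℕ => (SimpleGraph.binomialRandom (Fin n) (p n)).real
            {G : SimpleGraph (Fin n) | ε < |G.spanningProb - 0|})
          Filter.atTop (nhds 0)) := by
  refine ⟨⟨1 / 32000, by norm_num, SimpleGraph.tendsto_binomialRandom_spanningProb_le⟩, ?_⟩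
  intro p hp ε hε
  have h := (SimpleGraph.tendsto_binomialRandom_spanningProb_le p).const_sub 1
  rw [sub_self] at h
  refine tendsto_of_tendsto_of_tendsto_of_le_of_le' tendsto_const_nhds h
    (.of_forall fun n => MeasureTheory.measureReal_nonneg) ?_
  have hsmall : ∀ᶠ n in Filter.atTop, expNegDiv (1 / 32000) (p n : ℝ) < ε := by
    have hexp : Filter.Tendsto (fun x : ℝ => Real.exp (-(1 / 32000 * x⁻¹)))
        (nhdsWithin 0 (Set.Ioi 0)) (nhds 0) :=
      Real.tendsto_exp_neg_atTop_nhds_zero.comp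
        (tendsto_inv_nhdsGT_zero.const_mul_atTop (by norm_num))
    have hev := eventually_nhdsWithin_iff.mp (hexp.eventually (gt_mem_nhds hε))
    filter_upwards [hp.eventually hev] with n hn
    rw [expNegDiv]
    split_ifs with h0
    · exact hε
    · rw [neg_div, div_eq_mul_inv]
      exact hn (lt_of_le_of_ne (p n).2.1 (Ne.symm h0))
  filter_upwards [hsmall] with n hn
  rw [← MeasureTheory.probReal_compl_eq_one_sub (Set.toFinite _).measurableSet]
  -- Once `expNegDiv` is below `ε`, exceeding `ε` means violating the exponential bound.
  refine MeasureTheory.measureReal_mono fun G hG hle => ?_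
  have h0 : 0 ≤ G.spanningProb := by
    rw [SimpleGraph.spanningProb]
    positivity
  rw [Set.mem_ofPred_eq, sub_zero, abs_of_nonneg h0] at hG
  rw [Set.mem_ofPred_eq] at hle
  linarith
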